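/- **Setting.** Let $\bar v>0$, $n\ge 1$, $K,m\ge 0$. A seller posts a random price with values in given price levels $v_1,\dots,v_n\in[0,\bar v]$, charging $v_l$ with probability $x_l$, where $x\in\Delta_n=\{x\in\mathbb R^n_+:\sum_l x_l=1\}$; write $\pi_x=\sum_l x_l\delta_{v_l}$. A buyer with valuation $w$ pays $t_x(w)=\int_{[0,w]}u\,d\pi_x(u)=\sum_{l:\,v_l\le w}v_lx_l$ in expectation. Let $\phi_1,\dots,\phi_K:[0,\bar v]\to\mathbb R$ and $$\mathcal F=\Big\{F\in\mathcal P([0,\bar v]):\int\phi_k\,dF\ge 0,\ k=1,\dots,K\Big\},\qquad \mathrm{CR}(x)=\inf_{F\in\mathcal F}\frac{\int t_x\,dF}{\sup_{p\in[0,\bar v]}p\,(1-F(p-))},$$ where $1-F(p-)=F([p,\bar v])$ and $0/0:=0$. **Assumption.** There are $0<b_1<\dots<b_m<\bar v$ such that every $\phi_k$ is bounded on $[0,\bar v]$, continuous at every point of $[0,\bar v]\setminus\{b_1,\dots,b_m\}$, and nondecreasing on each interval containing no $b_s$. Moreover, for each $s$, either $\phi_k(b_s)\le\phi_k(b_s-)$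 for all $k$, or $\phi_k(b_s)\le\phi_k(b_s+)$ for all $k$. (The last condition holds in particular if there is one partition of $[0,\bar v]$ into finitely many nondegenerate intervals, with endpoints among $0,b_1,\dots,b_m,\bar v$, on each of which every $\phi_k$ is continuous and nondecreasing.) **Finite LP.** Let $u_1\le\dots\le u_{n+m}$ be the numbers $v_1,\dots,v_n,b_1,\dots,b_m$ sorted with repetitions, and let $u_{n+m+1}=\bar v$. Put $\underline\phi_{k,j}=\phi_k(u_j-)$ (read as $\phi_k(0)$ if $u_j=0$) and $S_j=\{l: v_l<u_j\}$. The LP is $$\sup\ r\quad\text{over } \lambda\in\mathbb R_+^{K\times(n+m+1)},\ x\in\mathbb R^n_+,\ r\in\mathbb R_+\quad\text{subject to}$$ $$\sum_k\underline\phi_{k,j}\lambda_{k,i}\le\sum_{l\in S_j}v_lx_l\quad(1\le j<i\le n+m+1),$$ $$r\,u_i+\sum_k\underline\phi_{k,j}\lambda_{k,i}\le\sum_{l\in S_j}v_lx_l\quad(1\le i\le j\le n+m+1),\qquad\sum_l x_l=1.$$ **Theorem (Finite-LP).** Under the Assumption the following hold. 1. For all $x\in\Delta_n$ and $r\ge 0$,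 there is $\lambda$ such that $(\lambda,x,r)$ is feasible for the LP if and only if there is $\lambda:\{1,\dots,K\}\times[0,\bar v]\to\mathbb R_+$ with $$\sum_k\phi_k(w)\lambda_k(p)\le t_x(w)\quad(0\le w<p\le\bar v),\qquad r\,p+\sum_k\phi_k(w)\lambda_k(p)\le t_x(w)\quad(0\le p\le w\le\bar v).$$ 2. If $\mathcal F\ne\emptyset$ and $(\lambda,x,r)$ is feasible for the LP, then $r\le\mathrm{CR}(x)$. 3. Suppose that some $F\in\mathcal F$ satisfies $\int\phi_k\,dF>0$ for every $k$ for which $\phi_k$ is not a step function, where $\phi_k$ is a step function if it is constant on each interval containing no $b_s$. (If all $\phi_k$ are step functions, this only says $\mathcal F\neq\emptyset$.) Then the LP solves the maximin problem: for every $x\in\Delta_n$, $\mathrm{CR}(x)$ is the largest $r$ for which some $(\lambda,x,r)$ is feasible for the LP; and $\max_{x\in\Delta_n}\mathrm{CR}(x)$ and the optimal value of the LP are both attained and equal. -/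

import Mathlib

open MeasureTheory Set

noncomputable section

namespace RobustPricing

/-- The interval `[0, vbar]` of valuations and prices. -/
abbrev Val (vbar : ℝ) : Type := Set.Icc (0 : ℝ) vbar

/-- The price distribution that posts the price `v l` with probability `x l`. -/
def levelPricing {vbar : ℝ} {n : ℕ} (v : Fin n → Val vbar) (x : Fin n → ℝ) :
    Measure (Val vbar) :=
  ∑ l, ENNReal.ofReal (x l) • Measure.dirac (v l)

/-- All randomizations over the given price levels `v`. -/
def levelPricings {vbar : ℝ} {n : ℕ} (v : Fin n → Val vbar) : Set (Measure (Val vbar)) :=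
  levelPricing v '' stdSimplex ℝ (Fin n)

/-- Expected payment of a buyer of valuation `w`, who buys at every posted price `≤ w`. -/
def payment {vbar : ℝ} (π : Measure (Val vbar)) (w : Val vbar) : ℝ :=
  ∫ u in Set.Iic w, (u : ℝ) ∂π

/-- Expected revenue of the price distribution `π` under the valuation distribution `F`. -/
def revenue {vbar : ℝ} (π : Measure (Val vbar)) (F : ProbabilityMeasure (Val vbar)) : ℝ :=
  ∫ w, payment π w ∂(F : Measure (Val vbar))

/-- The clairvoyant revenue `sup_p p (1 - F(p-))`. -/
def optRevenue {vbar : ℝ} (F : ProbabilityMeasure (Val vbar)) : ℝ :=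
  ⨆ p : Val vbar, (p : ℝ) * (1 - (F : Measure (Val vbar)).real (Set.Iio p))

/-- The ambiguity set: probability distributions `F` on `[0, vbar]` with `∫ φ k dF ≥ 0`
for every `k`. -/
def ambiguitySet {vbar : ℝ} {K : ℕ} (φ : Fin K → Val vbar → ℝ) :
    Set (ProbabilityMeasure (Val vbar)) :=
  {F | ∀ k, 0 ≤ ∫ w, φ k w ∂(F : Measure (Val vbar))}

/-- The competitive ratio of `π` over the ambiguity set. -/
def competitiveRatio {vbar : ℝ} {K : ℕ} (φ : Fin K → Val vbar → ℝ)
    (π : Measure (Val vbar)) : ℝ :=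
  sInf ((fun F => revenue π F / optRevenue F) '' ambiguitySet φ)

/-- `f` is bounded, continuous off the finitely many breakpoints `b`, and nondecreasing on each
interval without breakpoints. -/
structure PiecewiseIncreasing {vbar : ℝ} {m : ℕ} (b : Fin m → Val vbar)
    (f : Val vbar → ℝ) : Prop where
  bounded : ∃ C : ℝ, ∀ w, |f w| ≤ C
  continuousAt : ∀ w, w ∉ Set.range b → ContinuousAt f w
  mono : ∀ a c : Val vbar, a ≤ c → Disjoint (Set.Icc a c) (Set.range b) → f a ≤ f c

/-- `f` is constant on each interval without breakpoints (a step function). -/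
def PiecewiseConstant {vbar : ℝ} {m : ℕ} (b : Fin m → Val vbar)
    (f : Val vbar → ℝ) : Prop :=
  ∀ a c : Val vbar, a ≤ c → Disjoint (Set.Icc a c) (Set.range b) → f a = f c

/-- Each breakpoint can be attached to the segment on its left or to the one on its right,
simultaneously for all `k`.  This holds when the functions `φ k` are continuous and nondecreasing
on the segments of one common partition of `[0, vbar]` into nondegenerate intervals: at a
breakpoint all `φ k` are then left-continuous, or all are right-continuous. -/
def BreakpointsAttached {vbar : ℝ} {K m : ℕ} (b : Fin m → Val vbar)
    (φ : Fin K → Val vbar → ℝ) : Prop :=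
  ∀ s, (∀ k, φ k (b s) ≤ Function.leftLim (φ k) (b s)) ∨
    (∀ k, φ k (b s) ≤ Function.rightLim (φ k) (b s))

/-- Some distribution in the ambiguity set satisfies strictly every constraint whose function is
not a step function.  If all `φ k` are step functions, this says that the set is nonempty. -/
def StrictlyFeasible {vbar : ℝ} {K m : ℕ} (b : Fin m → Val vbar)
    (φ : Fin K → Val vbar → ℝ) : Prop :=
  ∃ F ∈ ambiguitySet φ, ∀ k, PiecewiseConstant b (φ k) ∨
    0 < ∫ w, φ k w ∂(F : Measure (Val vbar))

/-- The points `u_1 ≤ ... ≤ u_{n+m}`, that is, the price levels and breakpoints sorted in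
ascending order with repetitions, followed by `u_{n+m+1} = vbar`. -/
def mergedPoints {vbar : ℝ} (hv : 0 < vbar) {n m : ℕ} (v : Fin n → Val vbar)
    (b : Fin m → Val vbar) : Fin (n + m + 1) → Val vbar :=
  Fin.snoc (α := fun _ => Val vbar) (Fin.append v b ∘ Tuple.sort (Fin.append v b))
    ⟨vbar, hv.le, le_rfl⟩

/-- Feasibility of `(x, r, lam)` in the finite linear program.  The coefficient of `lam k i` in the
row `j` is the left limit of `φ k` at `u j`.  (At `0`, the left end of the domain `[0, vbar]`,
`Function.leftLim` is by definition the value of the function.) -/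
structure LPFeasible {vbar : ℝ} (hv : 0 < vbar) {K n m : ℕ} (φ : Fin K → Val vbar → ℝ)
    (v : Fin n → Val vbar) (b : Fin m → Val vbar)
    (x : Fin n → ℝ) (r : ℝ) (lam : Fin K → Fin (n + m + 1) → ℝ) : Prop where
  lam_nonneg : ∀ k i, 0 ≤ lam k i
  x_nonneg : ∀ l, 0 ≤ x l
  r_nonneg : 0 ≤ r
  below : ∀ i j, j < i →
    ∑ k, Function.leftLim (φ k) (mergedPoints hv v b j) * lam k i ≤
      ∑ l with v l < mergedPoints hv v b j, (v l : ℝ) * x l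
  above : ∀ i j, i ≤ j →
    r * (mergedPoints hv v b i : ℝ) +
        ∑ k, Function.leftLim (φ k) (mergedPoints hv v b j) * lam k i ≤
      ∑ l with v l < mergedPoints hv v b j, (v l : ℝ) * x l
  sum_x : ∑ l, x l = 1

/-- Feasibility of `(π, r, lam)` in the semi-infinite formulation of the pricing problem, which has
a multiplier `lam k p` for every price `p` and a constraint for every `p` and every valuation. -/
structure SemiInfiniteFeasible {vbar : ℝ} {K : ℕ} (φ : Fin K → Val vbar → ℝ)
    (π : Measure (Val vbar)) (r : ℝ) (lam : Fin K → Val vbar → ℝ) : Prop where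
  lam_nonneg : ∀ k p, 0 ≤ lam k p
  below : ∀ p w : Val vbar, w < p → ∑ k, φ k w * lam k p ≤ payment π w
  above : ∀ p w : Val vbar, p ≤ w →
    r * (p : ℝ) + ∑ k, φ k w * lam k p ≤ payment π w

end RobustPricing

end

namespace RobustPricing

open Filter Topology Function

/-! Column `i` of the finite program collects the constraints of a price just below `u i`, and row
`j` those of a valuation just below `u j`. Between consecutive merged points the payment is constant
and every `φ k` increases, so the left limits at the right end are the binding constraints.
Attachment of breakpoints places the value at a breakpoint under one of its two neighbouring
one-sided limits. Hence rounding prices up to merged points turns finite multipliers into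
semi-infinite ones (`exists_dominating_row`).

Both converse directions (semi-infinite to finite, and competitive ratio to finite) pass to
one-sided limits, along which multipliers need not converge. They therefore use Farkas' lemma column
by column: only an inequality for every dual vector `y` is needed (`exists_lpFeasible_of_dual`), and
it no longer contains multipliers.

Weak duality integrates the semi-infinite constraints against `F`. For strong duality, a normalized
`y` is a distribution with atoms "at `u j` from the left". Moving the atoms to actual points left of
`u j` preserves the constraints of step functions exactly and the others up to a small error, which
a small admixture of the strictly feasible `F` absorbs. The resulting distribution is in the
ambiguity set, and its ratio bound yields the dual inequality in the limit
(`mul_sum_le_of_mem_Ioo`). Finally, for fixed `F` the ratio is linear in `x`, so the competitive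
ratio is an infimum of continuous functions and attains its maximum on the simplex. -/

/-! ### Farkas' lemma -/

/-- **Farkas' lemma** for finitely many linear functionals on a real vector space. -/
theorem exists_nonneg_eq_sum_smul {ι V : Type*} [AddCommGroup V] [Module ℝ V] (s : Finset ι) :
    ∀ (A : ι → V →ₗ[ℝ] ℝ) (c : V →ₗ[ℝ] ℝ), (∀ x, (∀ i ∈ s, 0 ≤ A i x) → 0 ≤ c x) →
      ∃ u : ι → ℝ, (∀ i, 0 ≤ u i) ∧ c = ∑ i ∈ s, u i • A i := by
  classical
  induction s using Finset.induction_on with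
  | empty =>
    intro A c h
    refine ⟨0, fun _ => le_rfl, ?_⟩
    ext x
    have h1 := h x (by simp)
    have h2 := h (-x) (by simp)
    rw [map_neg] at h2
    simp only [Finset.sum_empty, LinearMap.zero_apply]
    linarith
  | insert a s ha ih =>
    intro A c h
    by_cases hs : ∀ x, (∀ i ∈ s, 0 ≤ A i x) → 0 ≤ c x
    · obtain ⟨u, hu, rfl⟩ := ih A c hs
      refine ⟨Function.update u a 0, fun i => ?_, ?_⟩
      · by_cases hi : i = a
        · simp [hi]
        · simp [hi, hu i]
      · rw [Finset.sum_insert ha]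
        simp only [Function.update_self, zero_smul, zero_add]
        refine Finset.sum_congr rfl fun i hi => ?_
        rw [Function.update_of_ne (ne_of_mem_of_not_mem hi ha)]
    · push Not at hs
      obtain ⟨z, hz, hcz⟩ := hs
      have haz : A a z < 0 := by
        by_contra! hcon
        have := h z (by simpa [hcon] using hz)
        linarith
      obtain ⟨y, hy, hcy, hay⟩ : ∃ y, (∀ i ∈ s, 0 ≤ A i y) ∧ c y < 0 ∧ A a y = -1 := by
        have hpos : 0 < (-A a z)⁻¹ := inv_pos.2 (by linarith)
        refine ⟨(-A a z)⁻¹ • z, fun i hi => ?_, ?_, ?_⟩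
        · simpa using mul_nonneg hpos.le (hz i hi)
        · simpa only [map_smul, smul_eq_mul] using mul_neg_of_pos_of_neg hpos hcz
        · rw [map_smul, smul_eq_mul, inv_neg, neg_mul, inv_mul_cancel₀ haz.ne]
      -- Since `A a y = -1`, the map `x ↦ x + A a x • y` projects onto the kernel of `A a`.
      -- Composing all functionals with it makes constraint `a` void, so the induction hypothesis
      -- applies; expanding the result gives the coefficient of `A a` used below.
      obtain ⟨u, hu, hcu⟩ := ih (fun i => A i + A i y • A a) (c + c y • A a) (by
        intro x hx
        have := h (x + A a x • y) (by
          intro i hi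
          rcases Finset.mem_insert.1 hi with rfl | hi
          · simp [hay]
          · have := hx i hi
            simp only [LinearMap.add_apply, LinearMap.smul_apply, smul_eq_mul, map_add,
              map_smul] at this ⊢
            linarith)
        simp only [LinearMap.add_apply, LinearMap.smul_apply, smul_eq_mul, map_add,
          map_smul] at this ⊢
        linarith)
      refine ⟨Function.update u a (∑ i ∈ s, u i * A i y - c y), fun i => ?_, ?_⟩
      · by_cases hi : i = a
        · subst hi
          have := Finset.sum_nonneg fun i hi => mul_nonneg (hu i) (hy i hi)
          rw [Function.update_self]
          linarith
        · simp [hi, hu i]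
      · rw [Finset.sum_insert ha, Function.update_self, Finset.sum_congr rfl
          (g := fun i => u i • A i)
          fun i hi => by rw [Function.update_of_ne (ne_of_mem_of_not_mem hi ha)]]
        ext x
        have := congrArg (fun f => f x) hcu
        simp only [LinearMap.add_apply, LinearMap.smul_apply, smul_eq_mul,
          LinearMap.sum_apply, mul_add, Finset.sum_add_distrib, sub_mul, Finset.sum_mul,
          mul_assoc] at this ⊢
        linarith

/-- Farkas' lemma for a finite system of linear inequalities in nonnegative unknowns. -/
theorem exists_nonneg_sum_mul_le {ι κ : Type*} [Fintype ι] [Fintype κ] (a : ι → κ → ℝ)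
    (c : ι → ℝ)
    (h : ∀ y : ι → ℝ, (∀ j, 0 ≤ y j) → (∀ k, 0 ≤ ∑ j, y j * a j k) → 0 ≤ ∑ j, y j * c j) :
    ∃ z : κ → ℝ, (∀ k, 0 ≤ z k) ∧ ∀ j, ∑ k, a j k * z k ≤ c j := by
  classical
  let lin (d : ι → ℝ) : (ι → ℝ) →ₗ[ℝ] ℝ := ∑ j, d j • LinearMap.proj j
  have lin_apply (d y) : lin d y = ∑ j, y j * d j := by simp [lin, mul_comm]
  obtain ⟨u, hu, hc⟩ := exists_nonneg_eq_sum_smul (Finset.univ : Finset (κ ⊕ ι))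
    (Sum.elim (fun k => lin fun j => a j k) fun j => LinearMap.proj j) (lin c) (by
      intro y hy
      rw [lin_apply]
      refine h y (fun j => by simpa using hy (Sum.inr j) (Finset.mem_univ _)) fun k => ?_
      simpa [lin_apply] using hy (Sum.inl k) (Finset.mem_univ _))
  refine ⟨fun k => u (Sum.inl k), fun k => hu _, fun j => ?_⟩
  -- Evaluation at the unit vector `j` reads off inequality `j`, with the multiplier of the
  -- constraint `0 ≤ y j` as its slack.
  have := congrArg (fun f => f (Pi.single j 1)) hc
  simp only [lin_apply, LinearMap.add_apply, LinearMap.sum_apply, LinearMap.smul_apply,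
    smul_eq_mul, Fintype.sum_sum_type, Sum.elim_inl, Sum.elim_inr, LinearMap.proj_apply, Pi.single_apply,
    ite_mul, one_mul, zero_mul, Finset.sum_ite_eq', Finset.mem_univ, if_true,
    mul_ite, mul_one, mul_zero] at this
  rw [this]
  have h2 := hu (Sum.inr j)
  simp only [mul_comm (a j _)]
  linarith

/-! ### One-sided limits of piecewise increasing functions -/

section Limits

variable {vbar : ℝ}

theorem nhdsLT_neBot {u : Val vbar} (hu : (u : ℝ) ≠ 0) : (𝓝[<] u).NeBot := by
  have h0 : (⟨0, le_rfl, u.2.1.trans u.2.2⟩ : Val vbar) < u :=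
    lt_of_le_of_ne u.2.1 fun h => hu (congrArg Subtype.val h).symm
  exact nhdsLT_neBot_of_exists_lt ⟨_, h0⟩

theorem nhdsGT_neBot {u : Val vbar} (hu : (u : ℝ) < vbar) : (𝓝[>] u).NeBot := by
  have h0 : u < (⟨vbar, u.2.1.trans u.2.2, le_rfl⟩ : Val vbar) := hu
  exact nhdsGT_neBot_of_exists_gt ⟨_, h0⟩

/-- Near the left of a point there are no other points of a given finite set. -/
theorem exists_lt_disjoint_Ioo {s : Set (Val vbar)} (hs : s.Finite) {u : Val vbar}
    (hu : (u : ℝ) ≠ 0) : ∃ a < u, Disjoint (Ioo a u) s := by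
  have h0 : (⟨0, le_rfl, u.2.1.trans u.2.2⟩ : Val vbar) < u :=
    lt_of_le_of_ne u.2.1 fun h => hu (congrArg Subtype.val h).symm
  have h1 : (s \ {u})ᶜ ∈ 𝓝[<] u := mem_nhdsWithin_of_mem_nhds <|
    (hs.subset sdiff_subset).isClosed.isOpen_compl.mem_nhds (by simp)
  obtain ⟨a, ha, hsub⟩ := (mem_nhdsLT_iff_exists_Ioo_subset' h0).1 h1
  refine ⟨a, ha, Set.disjoint_left.2 fun w hw hws => hsub hw ⟨hws, ?_⟩⟩
  exact hw.2.ne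

theorem exists_gt_disjoint_Ioo {s : Set (Val vbar)} (hs : s.Finite) {u : Val vbar}
    (hu : (u : ℝ) < vbar) : ∃ a > u, Disjoint (Ioo u a) s := by
  have h0 : u < (⟨vbar, u.2.1.trans u.2.2, le_rfl⟩ : Val vbar) := hu
  have h1 : (s \ {u})ᶜ ∈ 𝓝[>] u := mem_nhdsWithin_of_mem_nhds <|
    (hs.subset sdiff_subset).isClosed.isOpen_compl.mem_nhds (by simp)
  obtain ⟨a, ha, hsub⟩ := (mem_nhdsGT_iff_exists_Ioo_subset' h0).1 h1
  refine ⟨a, ha, Set.disjoint_left.2 fun w hw hws => hsub hw ⟨hws, ?_⟩⟩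
  exact hw.1.ne'

namespace PiecewiseIncreasing

variable {m : ℕ} {b : Fin m → Val vbar} {f : Val vbar → ℝ}

theorem monotoneOn_Ioo (hf : PiecewiseIncreasing b f) {a c : Val vbar}
    (h : Disjoint (Ioo a c) (range b)) : MonotoneOn f (Ioo a c) := fun w hw z hz hwz =>
  hf.mono w z hwz (h.mono_left (Icc_subset_Ioo hw.1 hz.2))

/-- Boundedness and monotonicity near `u` make the limit exist, so that `leftLim` is not its default
value `f u`. -/
theorem tendsto_leftLim (hf : PiecewiseIncreasing b f) {u : Val vbar} (hu : (u : ℝ) ≠ 0) :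
    Tendsto f (𝓝[<] u) (𝓝 (leftLim f u)) := by
  obtain ⟨a, ha, hab⟩ := exists_lt_disjoint_Ioo (finite_range b) hu
  obtain ⟨C, hC⟩ := hf.bounded
  exact tendsto_leftLim_of_tendsto ⟨_, MonotoneOn.tendsto_nhdsWithin_Ioo_left
    (nonempty_Ioo.2 ha) (hf.monotoneOn_Ioo hab)
    ⟨C, by rintro _ ⟨w, -, rfl⟩; exact (abs_le.1 (hC w)).2⟩⟩

theorem tendsto_rightLim (hf : PiecewiseIncreasing b f) {u : Val vbar} (hu : (u : ℝ) < vbar) :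
    Tendsto f (𝓝[>] u) (𝓝 (rightLim f u)) := by
  obtain ⟨a, ha, hab⟩ := exists_gt_disjoint_Ioo (finite_range b) hu
  obtain ⟨C, hC⟩ := hf.bounded
  exact tendsto_rightLim_of_tendsto ⟨_, MonotoneOn.tendsto_nhdsWithin_Ioo_right
    (nonempty_Ioo.2 ha) (hf.monotoneOn_Ioo hab)
    ⟨-C, by rintro _ ⟨w, -, rfl⟩; exact (abs_le.1 (hC w)).1⟩⟩

/-- On the open gap `f` increases to its left limit at `u`. The only possible drop is at `w` itself,
when `w` is a breakpoint, and `hw` excludes it. -/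
theorem le_leftLim (hf : PiecewiseIncreasing b f) {w u : Val vbar} (hwu : w < u)
    (h : Disjoint (Ioo w u) (range b)) (hw : w ∈ range b → f w ≤ rightLim f w) :
    f w ≤ leftLim f u := by
  have hu : (u : ℝ) ≠ 0 := (w.2.1.trans_lt (show (w : ℝ) < u from hwu)).ne'
  have hw' : (w : ℝ) < vbar := (show (w : ℝ) < u from hwu).trans_le u.2.2
  have := nhdsLT_neBot hu
  have := nhdsGT_neBot hw'
  have key : ∀ z ∈ Ioo w u, f w ≤ f z := by
    intro z hz
    by_cases hwb : w ∈ range b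
    · refine (hw hwb).trans (le_of_tendsto (hf.tendsto_rightLim hw') ?_)
      filter_upwards [Ioo_mem_nhdsGT hz.1] with y hy
      exact hf.monotoneOn_Ioo h ⟨hy.1, hy.2.trans hz.2⟩ hz hy.2.le
    · refine hf.mono w z hz.1.le (Set.disjoint_left.2 fun y hy hyb => ?_)
      rcases hy.1.eq_or_lt with rfl | hlt
      · exact hwb hyb
      · exact Set.disjoint_left.1 h ⟨hlt, hy.2.trans_lt hz.2⟩ hyb
  refine ge_of_tendsto (hf.tendsto_leftLim hu) ?_
  filter_upwards [Ioo_mem_nhdsLT hwu] with z hz using key z hz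

theorem measurable (hf : PiecewiseIncreasing b f) : Measurable f := by
  refine measurable_of_measurable_on_compl_finite (range b) (finite_range b) ?_
  have : ContinuousOn f (range b)ᶜ := fun w hw => (hf.continuousAt w hw).continuousWithinAt
  exact this.domRestrict.measurable

theorem integrable (hf : PiecewiseIncreasing b f) (F : Measure (Val vbar)) [IsFiniteMeasure F] :
    Integrable f F := by
  obtain ⟨C, hC⟩ := hf.bounded
  exact Integrable.of_bound hf.measurable.aestronglyMeasurable C (.of_forall hC)

end PiecewiseIncreasing

/-- The filter of points that approach `u` from the left, where the left end `0` of the domain is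
approached by itself only. -/
noncomputable def leftApproach (u : Val vbar) : Filter (Val vbar) := if (u : ℝ) = 0 then pure u else 𝓝[<] u

theorem leftApproach_of_eq {u : Val vbar} (hu : (u : ℝ) = 0) : leftApproach u = pure u := if_pos hu

theorem leftApproach_of_ne {u : Val vbar} (hu : (u : ℝ) ≠ 0) : leftApproach u = 𝓝[<] u :=
  if_neg hu

instance (u : Val vbar) : (leftApproach u).NeBot := by
  by_cases hu : (u : ℝ) = 0
  · rw [leftApproach_of_eq hu]; infer_instance
  · rw [leftApproach_of_ne hu]; exact nhdsLT_neBot hu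

theorem leftApproach_le_nhds (u : Val vbar) : leftApproach u ≤ 𝓝 u := by
  by_cases hu : (u : ℝ) = 0
  · rw [leftApproach_of_eq hu]; exact pure_le_nhds u
  · rw [leftApproach_of_ne hu]; exact nhdsWithin_le_nhds

theorem eventually_leftApproach_le (u : Val vbar) : ∀ᶠ w in leftApproach u, w ≤ u := by
  by_cases hu : (u : ℝ) = 0
  · rw [leftApproach_of_eq hu]; simp
  · rw [leftApproach_of_ne hu]
    filter_upwards [self_mem_nhdsWithin] with w hw using le_of_lt hw

theorem PiecewiseIncreasing.tendsto_leftApproach {m : ℕ} {b : Fin m → Val vbar}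
    {f : Val vbar → ℝ} (hf : PiecewiseIncreasing b f) (u : Val vbar) :
    Tendsto f (leftApproach u) (𝓝 (leftLim f u)) := by
  by_cases hu : (u : ℝ) = 0
  · rw [leftApproach_of_eq hu, leftLim_eq_of_isBot (fun w => by
      change (u : ℝ) ≤ w; rw [hu]; exact w.2.1)]
    exact tendsto_pure_nhds f u
  · rw [leftApproach_of_ne hu]; exact hf.tendsto_leftLim hu

/-- A step function attains its left limit exactly. This is why the strict feasibility condition can
exempt step functions. -/
theorem PiecewiseConstant.eventually_leftApproach_eq {m : ℕ} {b : Fin m → Val vbar}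
    {f : Val vbar → ℝ} (hc : PiecewiseConstant b f) (u : Val vbar) :
    ∀ᶠ w in leftApproach u, f w = leftLim f u := by
  by_cases hu : (u : ℝ) = 0
  · rw [leftApproach_of_eq hu, leftLim_eq_of_isBot (fun w => by
      change (u : ℝ) ≤ w; rw [hu]; exact w.2.1)]
    simp
  · rw [leftApproach_of_ne hu]
    have := nhdsLT_neBot hu
    obtain ⟨a, ha, hab⟩ := exists_lt_disjoint_Ioo (finite_range b) hu
    obtain ⟨c, hac, hcu⟩ := exists_between ha
    have key : ∀ w ∈ Ioo a u, f w = f c := by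
      intro w hw
      rcases le_total w c with h | h
      · exact hc w c h (hab.mono_left (Icc_subset_Ioo hw.1 hcu))
      · exact (hc c w h (hab.mono_left (Icc_subset_Ioo hac hw.2))).symm
    have hev : ∀ᶠ w in 𝓝[<] u, f w = f c := by
      filter_upwards [Ioo_mem_nhdsLT ha] with w hw using key w hw
    have : leftLim f u = f c :=
      leftLim_eq_of_tendsto (tendsto_const_nhds.congr' (hev.mono fun _ h => h.symm))
    rwa [this]

end Limits

/-! ### Payments under a randomization over price levels -/

theorem integral_sum_ofReal_smul_dirac {α ι : Type*} [MeasurableSpace α]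
    [MeasurableSingletonClass α] [Fintype ι] {x : ι → ℝ} (hx : ∀ i, 0 ≤ x i) (v : ι → α)
    (g : α → ℝ) :
    ∫ a, g a ∂(∑ i, ENNReal.ofReal (x i) • Measure.dirac (v i)) = ∑ i, x i * g (v i) := by
  rw [integral_finsetSum_measure fun i _ =>
    (integrable_dirac (by simp)).smul_measure ENNReal.ofReal_ne_top]
  refine Finset.sum_congr rfl fun i _ => ?_
  rw [integral_smul_measure, integral_dirac, ENNReal.toReal_ofReal (hx i), smul_eq_mul]

section Payment

variable {vbar : ℝ} {n : ℕ} {v : Fin n → Val vbar} {x : Fin n → ℝ}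

theorem payment_levelPricing (hx : ∀ l, 0 ≤ x l) (w : Val vbar) :
    payment (levelPricing v x) w = ∑ l with v l ≤ w, (v l : ℝ) * x l := by
  rw [payment, ← integral_indicator measurableSet_Iic, levelPricing,
    integral_sum_ofReal_smul_dirac hx, Finset.sum_filter]
  refine Finset.sum_congr rfl fun l _ => ?_
  by_cases h : v l ≤ w
  · simp [h, mul_comm]
  · simp [h]

theorem monotone_sum_filter {s t : Fin n → Prop} [DecidablePred s] [DecidablePred t]
    (hx : ∀ l, 0 ≤ x l) (h : ∀ l, s l → t l) :
    ∑ l with s l, (v l : ℝ) * x l ≤ ∑ l with t l, (v l : ℝ) * x l :=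
  Finset.sum_le_sum_of_subset_of_nonneg
    (fun l hl => by simpa using h l (by simpa using hl)) fun l _ _ => mul_nonneg (v l).2.1 (hx l)

theorem payment_nonneg (hx : ∀ l, 0 ≤ x l) (w : Val vbar) :
    0 ≤ payment (levelPricing v x) w := by
  rw [payment_levelPricing hx]
  exact Finset.sum_nonneg fun l _ => mul_nonneg (v l).2.1 (hx l)

theorem payment_monotone (hx : ∀ l, 0 ≤ x l) : Monotone (payment (levelPricing v x)) := by
  intro w z hwz
  rw [payment_levelPricing hx, payment_levelPricing hx]
  exact monotone_sum_filter hx fun l hl => hl.trans hwz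

theorem integrable_payment (hx : ∀ l, 0 ≤ x l) (F : Measure (Val vbar)) [IsFiniteMeasure F] :
    Integrable (payment (levelPricing v x)) F := by
  refine Integrable.of_bound (payment_monotone hx).measurable.aestronglyMeasurable
    (∑ l, (v l : ℝ) * x l) (.of_forall fun w => ?_)
  rw [Real.norm_of_nonneg (payment_nonneg hx w), payment_levelPricing hx]
  exact Finset.sum_le_sum_of_subset_of_nonneg (Finset.filter_subset _ _)
    fun l _ _ => mul_nonneg (v l).2.1 (hx l)

/-- Just left of `u` the price `u` itself is not yet paid, whence the strict inequality. At `u = 0`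
the point itself is used, but a price level `0` contributes nothing. -/
theorem eventually_payment_eq (hx : ∀ l, 0 ≤ x l) (u : Val vbar) :
    ∀ᶠ w in leftApproach u,
      payment (levelPricing v x) w = ∑ l with v l < u, (v l : ℝ) * x l := by
  by_cases hu : (u : ℝ) = 0
  · rw [leftApproach_of_eq hu, eventually_pure, payment_levelPricing hx, Finset.sum_filter,
      Finset.sum_filter]
    refine Finset.sum_congr rfl fun l _ => ?_
    have h1 : ¬ v l < u := fun h => by
      have h2 : (v l : ℝ) < u := h
      have := (v l).2.1
      linarith
    rw [if_neg h1]
    by_cases h : v l ≤ u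
    · have h2 : (v l : ℝ) ≤ u := h
      have h3 : (v l : ℝ) = 0 := le_antisymm (h2.trans hu.le) (v l).2.1
      simp [h3]
    · simp [h]
  · rw [leftApproach_of_ne hu]
    obtain ⟨a, ha, hav⟩ := exists_lt_disjoint_Ioo (finite_range v) hu
    filter_upwards [Ioo_mem_nhdsLT ha] with w hw
    rw [payment_levelPricing hx]
    congr 1
    ext l
    simp only [Finset.mem_filter, Finset.mem_univ, true_and]
    refine ⟨fun h => h.trans_lt hw.2, fun h => ?_⟩
    by_contra! hlt
    exact Set.disjoint_left.1 hav ⟨hw.1.trans hlt, h⟩ (mem_range_self l)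

end Payment

variable {vbar : ℝ} {K n m : ℕ}

/-! ### The merged points -/

section MergedPoints

variable (hv : 0 < vbar) (v : Fin n → Val vbar) (b : Fin m → Val vbar)

theorem mergedPoints_last : mergedPoints hv v b (Fin.last _) = ⟨vbar, hv.le, le_rfl⟩ := by
  simp [mergedPoints]

theorem mergedPoints_monotone : Monotone (mergedPoints hv v b) := by
  intro i j hij
  induction j using Fin.lastCases with
  | last =>
    rw [mergedPoints_last]
    exact (mergedPoints hv v b i).2.2
  | cast j =>
    induction i using Fin.lastCases with
    | last => exact absurd hij (not_le.2 (Fin.castSucc_lt_last j))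
    | cast i =>
      simp only [mergedPoints, Fin.snoc_castSucc]
      exact Tuple.monotone_sort (Fin.append v b) (Fin.castSucc_le_castSucc_iff.1 hij)

theorem exists_mergedPoints_eq_append (i : Fin (n + m)) :
    ∃ j, mergedPoints hv v b j = Fin.append v b i :=
  ⟨((Tuple.sort (Fin.append v b)).symm i).castSucc, by simp [mergedPoints]⟩

theorem exists_mergedPoints_eq_level (l : Fin n) : ∃ j, mergedPoints hv v b j = v l := by
  simpa using exists_mergedPoints_eq_append hv v b (Fin.castAdd m l)

theorem exists_mergedPoints_eq_breakpoint (s : Fin m) : ∃ j, mergedPoints hv v b j = b s := by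
  simpa using exists_mergedPoints_eq_append hv v b (Fin.natAdd n s)

theorem exists_least_index {N : ℕ} {P : Fin N → Prop} (h : ∃ i, P i) :
    ∃ i, P i ∧ ∀ j, P j → i ≤ j :=
  ⟨wellFounded_lt.min {i | P i} h, wellFounded_lt.min_mem {i | P i} h,
    fun _ hj => wellFounded_lt.min_le hj⟩

variable {v b} {φ : Fin K → Val vbar → ℝ}

/-- Each valuation `w` is dominated by one of the rows of the finite program, and this row lies on
the same side of a price `p` as `w` once `p` is rounded up to a merged point. -/
theorem exists_dominating_row (hφ : ∀ k, PiecewiseIncreasing b (φ k))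
    (hb : ∀ s, (b s : ℝ) < vbar) (hφb : BreakpointsAttached b φ) {x : Fin n → ℝ}
    (hx : ∀ l, 0 ≤ x l) (w : Val vbar) :
    ∃ j, (∀ k, φ k w ≤ leftLim (φ k) (mergedPoints hv v b j)) ∧
      ∑ l with v l < mergedPoints hv v b j, (v l : ℝ) * x l ≤ payment (levelPricing v x) w ∧
      ∀ p i, p ≤ mergedPoints hv v b i → (∀ i', p ≤ mergedPoints hv v b i' → i ≤ i') →
        (p ≤ w → i ≤ j) ∧ (w < p → j ≤ i) := by
  set u := mergedPoints hv v b with hu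
  have hmono : Monotone u := mergedPoints_monotone hv v b
  -- If `w` can be attached to the segment on its right, the row is the first merged point above
  -- `w`: no breakpoint or price level lies strictly between.
  by_cases hw : (w : ℝ) < vbar ∧ (w ∈ range b → ∀ k, φ k w ≤ rightLim (φ k) w)
  · obtain ⟨j, hj, hmin⟩ := exists_least_index (P := fun j => w < u j)
      ⟨Fin.last _, by rw [hu, mergedPoints_last]; exact hw.1⟩
    refine ⟨j, fun k => (hφ k).le_leftLim hj ?_ fun h => hw.2 h k, ?_, fun p i hpi hi => ⟨?_, ?_⟩⟩
    · refine Set.disjoint_left.2 ?_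
      rintro _ hs ⟨s, rfl⟩
      obtain ⟨j', hj'⟩ := exists_mergedPoints_eq_breakpoint hv v b s
      rw [← hj'] at hs
      exact absurd hs.2 (not_lt.2 (hmono (hmin j' hs.1)))
    · rw [payment_levelPricing hx]
      refine monotone_sum_filter hx fun l hl => ?_
      obtain ⟨j', hj'⟩ := exists_mergedPoints_eq_level hv v b l
      rw [← hj'] at hl ⊢
      by_contra! hlt
      exact absurd hl (not_lt.2 (hmono (hmin j' hlt)))
    · exact fun hpw => hi j (hpw.trans hj.le)
    · exact fun hwp => hmin i (hwp.trans_le hpi)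
  -- Otherwise `w` is itself a merged point, namely a breakpoint attached to its left or `vbar`, and
  -- its own row dominates.
  · obtain ⟨j, hj, hle⟩ : ∃ j, u j = w ∧ ∀ k, φ k w ≤ leftLim (φ k) w := by
      by_cases hwb : w ∈ range b
      · obtain ⟨s, rfl⟩ := hwb
        obtain ⟨j, hj⟩ := exists_mergedPoints_eq_breakpoint hv v b s
        refine ⟨j, hj, (hφb s).resolve_right fun h => hw ⟨hb s, fun _ => h⟩⟩
      · refine ⟨Fin.last _, ?_, fun k => ?_⟩
        · rw [hu, mergedPoints_last]
          exact Subtype.ext (le_antisymm (not_lt.1 fun h => hw ⟨h, fun h => absurd h hwb⟩) w.2.2)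
        · exact (((hφ k).continuousAt w hwb).continuousWithinAt.leftLim_eq).ge
    refine ⟨j, by rwa [hj], ?_, fun p i hpi hi => ⟨fun hpw => hi j (hj ▸ hpw), fun hwp => ?_⟩⟩
    · rw [payment_levelPricing hx, hj]
      exact monotone_sum_filter hx fun l hl => hl.le
    · by_contra! hlt
      exact absurd (hwp.trans_le hpi) (not_lt.2 (hj ▸ hmono hlt.le))

/-- Feasibility in the finite program implies feasibility in the semi-infinite program. -/
theorem LPFeasible.exists_semiInfiniteFeasible (hφ : ∀ k, PiecewiseIncreasing b (φ k))
    (hb : ∀ s, (b s : ℝ) < vbar) (hφb : BreakpointsAttached b φ) {x : Fin n → ℝ} {r : ℝ}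
    {lam : Fin K → Fin (n + m + 1) → ℝ} (h : LPFeasible hv φ v b x r lam) :
    ∃ lam, SemiInfiniteFeasible φ (levelPricing v x) r lam := by
  have hex (p : Val vbar) : ∃ i, p ≤ mergedPoints hv v b i ∧
      ∀ i', p ≤ mergedPoints hv v b i' → i ≤ i' :=
    exists_least_index ⟨Fin.last _, by rw [mergedPoints_last]; exact p.2.2⟩
  choose i hpi hi using hex
  have hdom (p w : Val vbar) {j} (hj : ∀ k, φ k w ≤ leftLim (φ k) (mergedPoints hv v b j)) :
      ∑ k, φ k w * lam k (i p) ≤ ∑ k, leftLim (φ k) (mergedPoints hv v b j) * lam k (i p) :=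
    Finset.sum_le_sum fun k _ => mul_le_mul_of_nonneg_right (hj k) (h.lam_nonneg k _)
  have hr (p : Val vbar) : 0 ≤ r * (mergedPoints hv v b (i p) : ℝ) :=
    mul_nonneg h.r_nonneg (mergedPoints hv v b (i p)).2.1
  refine ⟨fun k p => lam k (i p), fun k p => h.lam_nonneg _ _, fun p w hwp => ?_,
    fun p w hpw => ?_⟩
  · obtain ⟨j, hj, hS, hside⟩ := exists_dominating_row hv hφ hb hφb h.x_nonneg w
    refine (hdom p w hj).trans (le_trans ?_ hS)
    rcases ((hside p (i p) (hpi p) (hi p)).2 hwp).lt_or_eq with hlt | heq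
    · exact h.below _ _ hlt
    -- On the diagonal only the row with the term `r * u i` is available. It is the stronger one, as
    -- that term is nonnegative.
    · have := h.above (i p) j heq.ge
      linarith [hr p]
  · obtain ⟨j, hj, hS, hside⟩ := exists_dominating_row hv hφ hb hφb h.x_nonneg w
    have h1 := h.above (i p) j ((hside p (i p) (hpi p) (hi p)).1 hpw)
    have h2 : r * (p : ℝ) ≤ r * (mergedPoints hv v b (i p) : ℝ) :=
      mul_le_mul_of_nonneg_left (hpi p) h.r_nonneg
    linarith [hdom p w hj]

/-- The dual criterion for feasibility in the finite program. -/
theorem exists_lpFeasible_of_dual {x : Fin n → ℝ} (hx : x ∈ stdSimplex ℝ (Fin n)) {r : ℝ}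
    (hr : 0 ≤ r)
    (h : ∀ i, ∀ y : Fin (n + m + 1) → ℝ, (∀ j, 0 ≤ y j) →
      (∀ k, 0 ≤ ∑ j, y j * leftLim (φ k) (mergedPoints hv v b j)) →
      0 ≤ ∑ j, y j * (∑ l with v l < mergedPoints hv v b j, (v l : ℝ) * x l -
        if i ≤ j then r * (mergedPoints hv v b i : ℝ) else 0)) :
    ∃ lam, LPFeasible hv φ v b x r lam := by
  -- The multipliers of different columns share no constraint once `x` and `r` are fixed, so Farkas'
  -- lemma applies to each column `i` separately.
  choose z hz hle using fun i => exists_nonneg_sum_mul_le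
    (fun j k => leftLim (φ k) (mergedPoints hv v b j)) _ (h i)
  refine ⟨fun k i => z i k, fun k i => hz i k, hx.1, hr, fun i j hij => ?_, fun i j hij => ?_,
    hx.2⟩
  · simpa [not_le.2 hij] using hle i j
  · have := hle i j
    rw [if_pos hij] at this
    linarith

/-- The price is fixed before the valuation moves. Unless `u = 0`, it lies strictly below `u`, so
`w` eventually passes it even when `u = u'`. -/
theorem eventually_eventually_le {u u' : Val vbar} (huu : u ≤ u') :
    ∀ᶠ p in leftApproach u, ∀ᶠ w in leftApproach u', p ≤ w := by
  by_cases hu : (u : ℝ) = 0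
  · rw [leftApproach_of_eq hu, eventually_pure]
    exact .of_forall fun w => (show (u : ℝ) ≤ w by rw [hu]; exact w.2.1)
  · rw [leftApproach_of_ne hu]
    filter_upwards [self_mem_nhdsWithin] with p hp
    exact leftApproach_le_nhds u' (eventually_ge_nhds (lt_of_lt_of_le hp huu))

/-- Feasibility in the semi-infinite program implies feasibility in the finite program. -/
theorem SemiInfiniteFeasible.exists_lpFeasible (hφ : ∀ k, PiecewiseIncreasing b (φ k))
    {x : Fin n → ℝ} (hx : x ∈ stdSimplex ℝ (Fin n)) {r : ℝ} (hr : 0 ≤ r)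
    {lam : Fin K → Val vbar → ℝ} (h : SemiInfiniteFeasible φ (levelPricing v x) r lam) :
    ∃ lam, LPFeasible hv φ v b x r lam := by
  -- The multipliers `lam k p` may be unbounded as `p` tends to `u i`. The dual inequality is proved
  -- for each nearby `p`, where they drop out, and only then is the limit taken.
  refine exists_lpFeasible_of_dual hv hx hr fun i y hy hdual => ?_
  set u := mergedPoints hv v b with hu
  have hmono : Monotone u := mergedPoints_monotone hv v b
  have hlim (j) (p : Val vbar) : Tendsto (fun w => ∑ k, φ k w * lam k p) (leftApproach (u j))
      (𝓝 (∑ k, leftLim (φ k) (u j) * lam k p)) :=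
    tendsto_finsetSum _ fun k _ => ((hφ k).tendsto_leftApproach (u j)).mul_const _
  have hrow (j) : ∀ᶠ p : Val vbar in leftApproach (u i), (if i ≤ j then r * (p : ℝ) else 0) +
      ∑ k, leftLim (φ k) (u j) * lam k p ≤ ∑ l with v l < u j, (v l : ℝ) * x l := by
    rcases lt_or_ge (u j) (u i) with hlt | hle
    · filter_upwards [leftApproach_le_nhds (u i) (eventually_gt_nhds hlt)] with p hp
      rw [if_neg fun hij => absurd hlt (not_lt.2 (hmono hij)), zero_add]
      refine le_of_tendsto (hlim j p) ?_
      filter_upwards [eventually_leftApproach_le (u j), eventually_payment_eq hx.1 (u j)]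
        with w hw hpay
      rw [← hpay]
      exact h.below p w (lt_of_le_of_lt hw hp)
    -- This case includes ties `u j = u i` with `j < i`. Their row lacks the term `r * p`, which may
    -- be dropped because it is nonnegative.
    · filter_upwards [eventually_eventually_le hle] with p hp
      have hrp : 0 ≤ r * (p : ℝ) := mul_nonneg hr p.2.1
      have : r * (p : ℝ) + ∑ k, leftLim (φ k) (u j) * lam k p ≤
          ∑ l with v l < u j, (v l : ℝ) * x l := by
        refine le_of_tendsto ((hlim j p).const_add _) ?_
        filter_upwards [hp, eventually_payment_eq hx.1 (u j)] with w hw hpay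
        rw [← hpay]
        exact h.above p w hw
      split_ifs <;> linarith
  have hcont : Tendsto (fun p : Val vbar => ∑ j, y j * (∑ l with v l < u j, (v l : ℝ) * x l -
      if i ≤ j then r * (p : ℝ) else 0)) (leftApproach (u i))
      (𝓝 (∑ j, y j * (∑ l with v l < u j, (v l : ℝ) * x l -
        if i ≤ j then r * (u i : ℝ) else 0))) := by
    refine Tendsto.mono_left (Continuous.tendsto ?_ (u i)) (leftApproach_le_nhds _)
    refine continuous_finsetSum _ fun j _ => continuous_const.mul (continuous_const.sub ?_)
    split_ifs <;> fun_prop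
  refine ge_of_tendsto hcont ?_
  filter_upwards [eventually_all.2 hrow] with p hp
  calc (0 : ℝ) ≤ ∑ k, (∑ j, y j * leftLim (φ k) (u j)) * lam k p :=
        Finset.sum_nonneg fun k _ => mul_nonneg (hdual k) (h.lam_nonneg k p)
    _ = ∑ j, y j * ∑ k, leftLim (φ k) (u j) * lam k p := by
        simp only [Finset.sum_mul, Finset.mul_sum, mul_assoc]
        exact Finset.sum_comm
    _ ≤ _ := Finset.sum_le_sum fun j _ =>
        mul_le_mul_of_nonneg_left (by linarith [hp j]) (hy j)

end MergedPoints

/-! ### Guarantees on the competitive ratio -/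

section Guarantee

theorem one_sub_real_Iio (F : ProbabilityMeasure (Val vbar)) (p : Val vbar) :
    1 - (F : Measure (Val vbar)).real (Iio p) = (F : Measure (Val vbar)).real (Ici p) := by
  rw [← probReal_compl_eq_one_sub measurableSet_Iio, compl_Iio]

theorem le_optRevenue (F : ProbabilityMeasure (Val vbar)) (p : Val vbar) :
    (p : ℝ) * (F : Measure (Val vbar)).real (Ici p) ≤ optRevenue F := by
  rw [← one_sub_real_Iio]
  refine le_ciSup (f := fun p : Val vbar =>
    (p : ℝ) * (1 - (F : Measure (Val vbar)).real (Iio p))) ⟨vbar, ?_⟩ p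
  rintro _ ⟨q, rfl⟩
  dsimp only
  rw [one_sub_real_Iio]
  exact (mul_le_of_le_one_right q.2.1 measureReal_le_one).trans q.2.2

theorem optRevenue_nonneg (F : ProbabilityMeasure (Val vbar)) : 0 ≤ optRevenue F :=
  Real.iSup_nonneg fun p => mul_nonneg p.2.1 (sub_nonneg.2 measureReal_le_one)

variable {v : Fin n → Val vbar} {b : Fin m → Val vbar} {φ : Fin K → Val vbar → ℝ}
  {x : Fin n → ℝ} {r : ℝ}

theorem revenue_nonneg (hx : ∀ l, 0 ≤ x l) (F : ProbabilityMeasure (Val vbar)) :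
    0 ≤ revenue (levelPricing v x) F :=
  integral_nonneg fun w => payment_nonneg hx w

theorem competitiveRatio_nonneg (hx : ∀ l, 0 ≤ x l) :
    0 ≤ competitiveRatio φ (levelPricing v x) := by
  refine Real.sInf_nonneg ?_
  rintro _ ⟨F, -, rfl⟩
  exact div_nonneg (revenue_nonneg hx F) (optRevenue_nonneg F)

theorem competitiveRatio_le (hx : ∀ l, 0 ≤ x l) {F : ProbabilityMeasure (Val vbar)}
    (hF : F ∈ ambiguitySet φ) :
    competitiveRatio φ (levelPricing v x) ≤ revenue (levelPricing v x) F / optRevenue F := by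
  refine csInf_le ⟨0, ?_⟩ (mem_image_of_mem _ hF)
  rintro _ ⟨F, -, rfl⟩
  exact div_nonneg (revenue_nonneg hx F) (optRevenue_nonneg F)

theorem competitiveRatio_mul_optRevenue_le (hx : ∀ l, 0 ≤ x l)
    {F : ProbabilityMeasure (Val vbar)} (hF : F ∈ ambiguitySet φ) :
    competitiveRatio φ (levelPricing v x) * optRevenue F ≤ revenue (levelPricing v x) F := by
  rcases (optRevenue_nonneg F).eq_or_lt with h | h
  · rw [← h, mul_zero]
    exact revenue_nonneg hx F
  · exact (le_div_iff₀ h).1 (competitiveRatio_le hx hF)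

/-- Weak duality for one price. -/
theorem SemiInfiniteFeasible.mul_le_revenue (hφ : ∀ k, PiecewiseIncreasing b (φ k))
    (hx : ∀ l, 0 ≤ x l) {lam : Fin K → Val vbar → ℝ}
    (h : SemiInfiniteFeasible φ (levelPricing v x) r lam)
    {F : ProbabilityMeasure (Val vbar)} (hF : F ∈ ambiguitySet φ) (p : Val vbar) :
    r * ((p : ℝ) * (F : Measure (Val vbar)).real (Ici p)) ≤ revenue (levelPricing v x) F := by
  set μ : Measure (Val vbar) := (F : Measure (Val vbar))
  have hφi (k) : Integrable (fun w => φ k w * lam k p) μ := ((hφ k).integrable μ).mul_const _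
  have h1 : Integrable ((Ici p).indicator fun _ => r * (p : ℝ)) μ :=
    (integrable_const _).indicator measurableSet_Ici
  have h2 : Integrable (fun w => ∑ k, φ k w * lam k p) μ := integrable_finsetSum _ fun k _ => hφi k
  have hle : ∫ w, ((Ici p).indicator (fun _ => r * (p : ℝ)) w + ∑ k, φ k w * lam k p) ∂μ ≤
      revenue (levelPricing v x) F := by
    refine integral_mono (h1.add h2) (integrable_payment hx μ) fun w => ?_
    by_cases hw : p ≤ w
    · simpa [hw] using h.above p w hw
    · simpa [hw] using h.below p w (not_le.1 hw)
  rw [integral_add h1 h2, integral_indicator_const _ measurableSet_Ici,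
    integral_finsetSum _ fun k _ => hφi k, smul_eq_mul] at hle
  have hnn : 0 ≤ ∑ k, ∫ w, φ k w * lam k p ∂μ := Finset.sum_nonneg fun k _ => by
    rw [integral_mul_const]
    exact mul_nonneg (hF k) (h.lam_nonneg k p)
  linarith

/-- If the clairvoyant revenue vanishes for some distribution in the ambiguity set, then no positive
ratio can be guaranteed. -/
theorem SemiInfiniteFeasible.nonpos_of_optRevenue_eq_zero (hv : 0 < vbar)
    (hφ : ∀ k, PiecewiseIncreasing b (φ k)) (hb : ∀ s, 0 < (b s : ℝ)) (hx : ∀ l, 0 ≤ x l)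
    {lam : Fin K → Val vbar → ℝ} (h : SemiInfiniteFeasible φ (levelPricing v x) r lam)
    {F : ProbabilityMeasure (Val vbar)} (hF : F ∈ ambiguitySet φ) (hopt : optRevenue F = 0) :
    r ≤ 0 := by
  -- The price `p` is taken positive but below all positive price levels and all breakpoints, so
  -- nothing is paid at `p` and every `φ k` is monotone on `[0, p]`.
  obtain ⟨a, ha, hdisj⟩ := exists_gt_disjoint_Ioo ((finite_range v).union (finite_range b))
    (u := ⟨0, le_rfl, hv.le⟩) hv
  obtain ⟨p, hp0, hpa⟩ := exists_between ha
  have hp : 0 < (p : ℝ) := hp0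
  have hpay : payment (levelPricing v x) p = 0 := by
    rw [payment_levelPricing hx]
    refine Finset.sum_eq_zero fun l hl => ?_
    have hl : v l ≤ p := by simpa using hl
    have : ¬ 0 < (v l : ℝ) := fun h0 =>
      Set.disjoint_left.1 hdisj ⟨h0, hl.trans_lt hpa⟩ (Or.inl (mem_range_self l))
    rw [le_antisymm (not_lt.1 this) (v l).2.1, zero_mul]
  have htail : (F : Measure (Val vbar)) (Ici p) = 0 := by
    have h1 := le_optRevenue F p
    rw [hopt] at h1
    have h2 : (F : Measure (Val vbar)).real (Ici p) = 0 :=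
      le_antisymm (nonpos_of_mul_nonpos_right h1 hp) measureReal_nonneg
    exact (measureReal_eq_zero_iff (by simp)).1 h2
  -- `F` lives below `p`, where `φ k ≤ φ k p`; hence `φ k p` is at least the integral of `φ k`,
  -- which is nonnegative.
  have hφp (k) : 0 ≤ φ k p := by
    have hae : ∀ᵐ w ∂(F : Measure (Val vbar)), φ k w ≤ φ k p := by
      have : ∀ᵐ w ∂(F : Measure (Val vbar)), w ∉ Ici p := measure_eq_zero_iff_ae_notMem.1 htail
      filter_upwards [this] with w hw
      refine (hφ k).mono w p (not_le.1 hw).le (Set.disjoint_left.2 ?_)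
      rintro _ hs ⟨s, rfl⟩
      exact Set.disjoint_left.1 hdisj ⟨hb s, hs.2.trans_lt hpa⟩ (Or.inr (mem_range_self s))
    have := integral_mono_ae ((hφ k).integrable _) (integrable_const (φ k p)) hae
    rw [integral_const, probReal_univ, one_smul] at this
    exact (hF k).trans this
  have h1 := h.above p p le_rfl
  rw [hpay] at h1
  have h2 : 0 ≤ ∑ k, φ k p * lam k p :=
    Finset.sum_nonneg fun k _ => mul_nonneg (hφp k) (h.lam_nonneg k p)
  exact nonpos_of_mul_nonpos_left (by linarith) hp

/-- Weak duality: the semi-infinite program gives guarantees on the competitive ratio. -/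
theorem SemiInfiniteFeasible.le_competitiveRatio (hv : 0 < vbar)
    (hφ : ∀ k, PiecewiseIncreasing b (φ k)) (hb : ∀ s, 0 < (b s : ℝ)) (hx : ∀ l, 0 ≤ x l)
    (hr : 0 ≤ r) {lam : Fin K → Val vbar → ℝ}
    (h : SemiInfiniteFeasible φ (levelPricing v x) r lam) (hne : (ambiguitySet φ).Nonempty) :
    r ≤ competitiveRatio φ (levelPricing v x) := by
  refine le_csInf (hne.image _) ?_
  rintro _ ⟨F, hF, rfl⟩
  rcases (optRevenue_nonneg F).eq_or_lt with hopt | hopt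
  -- Here the ratio is `0` by the convention for division by zero.
  · refine (h.nonpos_of_optRevenue_eq_zero hv hφ hb hx hF hopt.symm).trans ?_
    simp [← hopt]
  · have : Nonempty (Val vbar) := ⟨⟨0, le_rfl, hv.le⟩⟩
    refine (le_div_iff₀ hopt).2 ?_
    rw [optRevenue, Real.mul_iSup_of_nonneg hr]
    refine ciSup_le fun p => ?_
    rw [one_sub_real_Iio]
    exact h.mul_le_revenue hφ hx hF p

end Guarantee

/-! ### Strong duality -/

section StrongDuality

/-- The mixture of a finitely supported distribution with another distribution. -/
theorem exists_mixture {α ι : Type*} [MeasurableSpace α] [MeasurableSingletonClass α] [Fintype ι]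
    {y : ι → ℝ} (hy : ∀ j, 0 ≤ y j) (hy1 : ∑ j, y j = 1) {δ : ℝ} (hδ : δ ∈ Ioo (0 : ℝ) 1)
    (w : ι → α) (F : ProbabilityMeasure α) :
    ∃ G : ProbabilityMeasure α, ∀ g : α → ℝ, Integrable g (F : Measure α) →
      ∫ a, g a ∂(G : Measure α) =
        (1 - δ) * ∑ j, y j * g (w j) + δ * ∫ a, g a ∂(F : Measure α) := by
  have hy' (j) : 0 ≤ (1 - δ) * y j := mul_nonneg (by linarith [hδ.2]) (hy j)
  set μ : Measure α := ∑ j, ENNReal.ofReal ((1 - δ) * y j) • Measure.dirac (w j) +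
    ENNReal.ofReal δ • (F : Measure α) with hμ
  have hprob : IsProbabilityMeasure μ := by
    refine ⟨?_⟩
    simp only [hμ, Measure.add_apply, Measure.finsetSum_apply, Measure.smul_apply, measure_univ,
      smul_eq_mul, mul_one]
    rw [← ENNReal.ofReal_sum_of_nonneg fun j _ => hy' j, ← Finset.mul_sum, hy1,
      ← ENNReal.ofReal_add (by linarith [hδ.2]) hδ.1.le]
    simp
  refine ⟨⟨μ, hprob⟩, fun g hg => ?_⟩
  change ∫ a, g a ∂μ = _
  rw [hμ, integral_add_measure (integrable_finsetSum_measure.2 fun j _ =>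
      (integrable_dirac (by simp)).smul_measure ENNReal.ofReal_ne_top)
    (hg.smul_measure ENNReal.ofReal_ne_top), integral_sum_ofReal_smul_dirac hy',
    integral_smul_measure, ENNReal.toReal_ofReal hδ.1.le, smul_eq_mul, Finset.mul_sum]
  simp only [mul_assoc]

variable {v : Fin n → Val vbar} {b : Fin m → Val vbar} {φ : Fin K → Val vbar → ℝ}
  {x : Fin n → ℝ} {r : ℝ}

/-- Dual multipliers that sum to one, perturbed to a distribution in the ambiguity set with atoms
slightly to the left of the points `u j`, bound the ratio `r`. -/
theorem mul_sum_le_of_mem_Ioo (hφ : ∀ k, PiecewiseIncreasing b (φ k)) (hx : ∀ l, 0 ≤ x l)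
    (hr : 0 ≤ r)
    (hrev : ∀ F ∈ ambiguitySet φ, r * optRevenue F ≤ revenue (levelPricing v x) F)
    {F : ProbabilityMeasure (Val vbar)}
    (hF : ∀ k, 0 ≤ ∫ w, φ k w ∂(F : Measure (Val vbar)))
    (hF' : ∀ k, PiecewiseConstant b (φ k) ∨ 0 < ∫ w, φ k w ∂(F : Measure (Val vbar)))
    {ι : Type*} [Fintype ι] (u : ι → Val vbar) {y : ι → ℝ} (hy : ∀ j, 0 ≤ y j)
    (hy1 : ∑ j, y j = 1) (hdual : ∀ k, 0 ≤ ∑ j, y j * leftLim (φ k) (u j)) {T : Finset ι}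
    {p : Val vbar} (hp : ∀ j ∈ T, p < u j) {δ : ℝ} (hδ : δ ∈ Ioo (0 : ℝ) 1) :
    r * ((p : ℝ) * ((1 - δ) * ∑ j ∈ T, y j)) ≤
      (1 - δ) * ∑ j, y j * ∑ l with v l < u j, (v l : ℝ) * x l +
        δ * revenue (levelPricing v x) F := by
  have h1δ : 0 < 1 - δ := by linarith [hδ.2]
  have hcoord {P : ι → Val vbar → Prop} (h : ∀ j, ∀ᶠ w in leftApproach (u j), P j w) :
      ∀ᶠ w in Filter.pi fun j => leftApproach (u j), ∀ j, P j (w j) :=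
    eventually_all.2 fun j => (tendsto_eval_pi _ j).eventually (h j)
  have hmem : ∀ᶠ w in Filter.pi fun j => leftApproach (u j), ∀ k,
      0 ≤ (1 - δ) * ∑ j, y j * φ k (w j) + δ * ∫ w, φ k w ∂(F : Measure (Val vbar)) := by
    refine eventually_all.2 fun k => ?_
    rcases hF' k with hc | hpos
    · filter_upwards [hcoord fun j => hc.eventually_leftApproach_eq (u j)] with w hw
      simp only [hw]
      exact add_nonneg (mul_nonneg h1δ.le (hdual k)) (mul_nonneg hδ.1.le (hF k))
    · have hlim : Tendsto (fun w : ι → Val vbar =>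
          (1 - δ) * ∑ j, y j * φ k (w j) + δ * ∫ w, φ k w ∂(F : Measure (Val vbar)))
          (Filter.pi fun j => leftApproach (u j))
          (𝓝 ((1 - δ) * ∑ j, y j * leftLim (φ k) (u j) +
            δ * ∫ w, φ k w ∂(F : Measure (Val vbar)))) :=
        ((tendsto_finsetSum _ fun j _ => (((hφ k).tendsto_leftApproach (u j)).comp
          (tendsto_eval_pi _ j)).const_mul _).const_mul _).add_const _
      have hlt : 0 < (1 - δ) * ∑ j, y j * leftLim (φ k) (u j) +
          δ * ∫ w, φ k w ∂(F : Measure (Val vbar)) :=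
        add_pos_of_nonneg_of_pos (mul_nonneg h1δ.le (hdual k)) (mul_pos hδ.1 hpos)
      exact (hlim.eventually_const_lt hlt).mono fun w hw => le_of_lt hw
  have hT : ∀ᶠ w in Filter.pi fun j => leftApproach (u j), ∀ j, j ∈ T → p ≤ w j :=
    hcoord (P := fun j w => j ∈ T → p ≤ w) fun j => by
      by_cases hj : j ∈ T
      · filter_upwards [leftApproach_le_nhds (u j) (eventually_ge_nhds (hp j hj))] with w hw _
        exact hw
      · simp [hj]
  -- One choice of atoms meets finitely many eventual conditions: all moment constraints, atoms of
  -- `T` at or above `p`, and payments equal to their left limits.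
  obtain ⟨w, hwφ, hwT, hwpay⟩ := (hmem.and (hT.and
    (hcoord fun j => eventually_payment_eq (v := v) hx (u j)))).exists
  obtain ⟨G, hG⟩ := exists_mixture hy hy1 hδ w F
  have hGmem : G ∈ ambiguitySet φ := fun k => by
    rw [hG _ ((hφ k).integrable _)]
    exact hwφ k
  have hGrev : revenue (levelPricing v x) G =
      (1 - δ) * ∑ j, y j * ∑ l with v l < u j, (v l : ℝ) * x l +
        δ * revenue (levelPricing v x) F := by
    rw [revenue, hG _ (integrable_payment hx _)]
    simp only [hwpay, revenue]
  have hGtail : (1 - δ) * ∑ j ∈ T, y j ≤ (G : Measure (Val vbar)).real (Ici p) := by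
    have hind := hG ((Ici p).indicator fun _ => (1 : ℝ))
      ((integrable_const _).indicator measurableSet_Ici)
    rw [integral_indicator_const _ measurableSet_Ici, smul_eq_mul, mul_one] at hind
    rw [hind]
    refine le_add_of_le_of_nonneg (mul_le_mul_of_nonneg_left ?_ h1δ.le)
      (mul_nonneg hδ.1.le (integral_nonneg fun a => indicator_nonneg (fun _ _ => zero_le_one) a))
    calc ∑ j ∈ T, y j = ∑ j ∈ T, y j * (Ici p).indicator (fun _ => (1 : ℝ)) (w j) :=
          Finset.sum_congr rfl fun j hj => by simp [hwT j hj]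
      _ ≤ _ := Finset.sum_le_sum_of_subset_of_nonneg (Finset.subset_univ _) fun j _ _ =>
          mul_nonneg (hy j) (indicator_nonneg (fun _ _ => zero_le_one) _)
  calc r * ((p : ℝ) * ((1 - δ) * ∑ j ∈ T, y j))
      ≤ r * ((p : ℝ) * (G : Measure (Val vbar)).real (Ici p)) :=
        mul_le_mul_of_nonneg_left (mul_le_mul_of_nonneg_left hGtail p.2.1) hr
    _ ≤ r * optRevenue G := mul_le_mul_of_nonneg_left (le_optRevenue G p) hr
    _ ≤ _ := (hrev G hGmem).trans_eq hGrev

/-- The claim is homogeneous in `y`, so `y` may be normalized to total mass one. The bound for a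
mixture is then relaxed by `δ → 0` and, afterwards, `p ↑ q`. Prices `p < q` are needed because the
atoms sit to the left of the points `u j`, possibly below `q`. -/
theorem mul_sum_le_of_strictlyFeasible (hφ : ∀ k, PiecewiseIncreasing b (φ k))
    (hx : ∀ l, 0 ≤ x l) (hr : 0 ≤ r)
    (hrev : ∀ F ∈ ambiguitySet φ, r * optRevenue F ≤ revenue (levelPricing v x) F)
    (hsf : StrictlyFeasible b φ) {ι : Type*} [Fintype ι] (u : ι → Val vbar) {y : ι → ℝ}
    (hy : ∀ j, 0 ≤ y j) (hdual : ∀ k, 0 ≤ ∑ j, y j * leftLim (φ k) (u j)) {T : Finset ι}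
    {q : Val vbar} (hq : ∀ j ∈ T, q ≤ u j) :
    r * ((q : ℝ) * ∑ j ∈ T, y j) ≤ ∑ j, y j * ∑ l with v l < u j, (v l : ℝ) * x l := by
  obtain ⟨F, hF, hF'⟩ := hsf
  have hS (j) : 0 ≤ ∑ l with v l < u j, (v l : ℝ) * x l :=
    Finset.sum_nonneg fun l _ => mul_nonneg (v l).2.1 (hx l)
  have hrhs : 0 ≤ ∑ j, y j * ∑ l with v l < u j, (v l : ℝ) * x l :=
    Finset.sum_nonneg fun j _ => mul_nonneg (hy j) (hS j)
  by_cases hq0 : (q : ℝ) = 0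
  -- No price lies to the left of `q = 0`, but then the left side vanishes.
  · simpa [hq0] using hrhs
  rcases (Finset.sum_nonneg fun j (_ : j ∈ Finset.univ) => hy j).eq_or_lt with hY | hY
  · have hy0 (j) : y j = 0 :=
      (Finset.sum_eq_zero_iff_of_nonneg fun j _ => hy j).1 hY.symm j (Finset.mem_univ j)
    simp [hy0]
  set Y := ∑ j, y j
  have hnorm (f : ι → ℝ) : ∑ j, y j / Y * f j = (∑ j, y j * f j) / Y := by
    rw [Finset.sum_div]
    exact Finset.sum_congr rfl fun j _ => by ring
  have key : ∀ δ ∈ Ioo (0 : ℝ) 1, ∀ p : Val vbar, p < q →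
      r * ((p : ℝ) * ((1 - δ) * ∑ j ∈ T, y j / Y)) ≤
        (1 - δ) * ∑ j, y j / Y * ∑ l with v l < u j, (v l : ℝ) * x l +
          δ * revenue (levelPricing v x) F := fun δ hδ p hp =>
    mul_sum_le_of_mem_Ioo hφ hx hr hrev hF hF' u (fun j => div_nonneg (hy j) hY.le)
      (by rw [← Finset.sum_div, div_self hY.ne'])
      (fun k => by rw [hnorm]; exact div_nonneg (hdual k) hY.le)
      (fun j hj => hp.trans_le (hq j hj)) hδ
  have key' : ∀ p : Val vbar, p < q → r * ((p : ℝ) * ∑ j ∈ T, y j / Y) ≤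
      ∑ j, y j / Y * ∑ l with v l < u j, (v l : ℝ) * x l := by
    intro p hp
    refine le_of_tendsto_of_tendsto (b := 𝓝[>] (0 : ℝ))
      (f := fun δ => r * ((p : ℝ) * ((1 - δ) * ∑ j ∈ T, y j / Y)))
      (g := fun δ => (1 - δ) * ∑ j, y j / Y * ∑ l with v l < u j, (v l : ℝ) * x l +
          δ * revenue (levelPricing v x) F) ?_ ?_ ?_
    · exact tendsto_nhdsWithin_of_tendsto_nhds (Continuous.tendsto' (by fun_prop) _ _ (by simp))
    · exact tendsto_nhdsWithin_of_tendsto_nhds (Continuous.tendsto' (by fun_prop) _ _ (by simp))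
    · filter_upwards [Ioo_mem_nhdsGT one_pos] with δ hδ using key δ hδ p hp
  have := nhdsLT_neBot hq0
  have hlim : r * ((q : ℝ) * ∑ j ∈ T, y j / Y) ≤
      ∑ j, y j / Y * ∑ l with v l < u j, (v l : ℝ) * x l := by
    refine le_of_tendsto (x := 𝓝[<] q)
      (f := fun p : Val vbar => r * ((p : ℝ) * ∑ j ∈ T, y j / Y))
      (tendsto_nhdsWithin_of_tendsto_nhds (Continuous.tendsto (by fun_prop) q)) ?_
    filter_upwards [self_mem_nhdsWithin] with p hp using key' p hp
  rw [hnorm, ← Finset.sum_div, le_div_iff₀ hY] at hlim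
  calc r * ((q : ℝ) * ∑ j ∈ T, y j) = r * ((q : ℝ) * ((∑ j ∈ T, y j) / Y)) * Y := by
        field_simp
    _ ≤ _ := hlim

/-- Strong duality: the competitive ratio is feasible in the finite program. -/
theorem exists_lpFeasible_competitiveRatio (hv : 0 < vbar)
    (hφ : ∀ k, PiecewiseIncreasing b (φ k)) (hx : x ∈ stdSimplex ℝ (Fin n))
    (hsf : StrictlyFeasible b φ) :
    ∃ lam, LPFeasible hv φ v b x (competitiveRatio φ (levelPricing v x)) lam := by
  have hr : 0 ≤ competitiveRatio φ (levelPricing v x) := competitiveRatio_nonneg hx.1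
  refine exists_lpFeasible_of_dual hv hx hr fun i y hy hdual => ?_
  -- With `q = u i` and `T` the rows `j ≥ i`, the left side collects exactly the terms `r * u i` of
  -- column `i`.
  have := mul_sum_le_of_strictlyFeasible hφ hx.1 hr
    (fun F hF => competitiveRatio_mul_optRevenue_le hx.1 hF) hsf (mergedPoints hv v b) hy hdual
    (T := Finset.univ.filter fun j => i ≤ j) (q := mergedPoints hv v b i)
    fun j hj => mergedPoints_monotone hv v b (by simpa using hj)
  simp only [mul_sub, Finset.sum_sub_distrib, mul_ite, mul_zero, ← Finset.sum_filter,
    ← Finset.sum_mul]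
  linarith

/-- The competitive ratio is upper semicontinuous in the probabilities of the price levels. -/
theorem upperSemicontinuousOn_competitiveRatio (hne : (ambiguitySet φ).Nonempty) :
    UpperSemicontinuousOn (fun x => competitiveRatio φ (levelPricing v x))
      (stdSimplex ℝ (Fin n)) := by
  intro x hx c hc
  -- A single `F` with ratio below `c` at `x` suffices: its revenue is linear in the probabilities,
  -- so the ratio stays below `c` nearby.
  obtain ⟨_, ⟨F, hF, rfl⟩, hlt⟩ := exists_lt_of_csInf_lt (hne.image _) hc
  have hrev : ∀ x ∈ stdSimplex ℝ (Fin n), revenue (levelPricing v x) F =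
      ∑ l, ((v l : ℝ) * (F : Measure (Val vbar)).real (Ici (v l))) * x l := by
    intro x hx
    have hpay (w : Val vbar) : payment (levelPricing v x) w =
        ∑ l, (Ici (v l)).indicator (fun _ => (v l : ℝ) * x l) w := by
      simp only [payment_levelPricing hx.1, Finset.sum_filter, indicator_apply, mem_Ici]
    simp only [revenue, hpay]
    rw [integral_finsetSum _ fun l _ => (integrable_const _).indicator measurableSet_Ici]
    refine Finset.sum_congr rfl fun l _ => ?_
    rw [integral_indicator_const _ measurableSet_Ici, smul_eq_mul]
    ring
  have hcont : Continuous fun x : Fin n → ℝ =>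
      (∑ l, ((v l : ℝ) * (F : Measure (Val vbar)).real (Ici (v l))) * x l) / optRevenue F := by
    fun_prop
  dsimp only at hlt
  rw [hrev x hx] at hlt
  filter_upwards [mem_nhdsWithin_of_mem_nhds (hcont.tendsto x (eventually_lt_nhds hlt)),
    self_mem_nhdsWithin] with z hz hzΔ
  refine (competitiveRatio_le hzΔ.1 hF).trans_lt ?_
  rw [hrev z hzΔ]
  exact hz

end StrongDuality

end RobustPricing

theorem mainTheorem1 {vbar : ℝ} (hv : 0 < vbar) {K n m : ℕ} (hn : 0 < n)
    (φ : Fin K → RobustPricing.Val vbar → ℝ)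
    (b : Fin m → RobustPricing.Val vbar) (hb : StrictMono b)
    (hb_mem : ∀ s, (b s : ℝ) ∈ Set.Ioo 0 vbar)
    (hφ : ∀ k, RobustPricing.PiecewiseIncreasing b (φ k))
    (hφb : RobustPricing.BreakpointsAttached b φ)
    (v : Fin n → RobustPricing.Val vbar) :
    -- for each randomization over the price levels, the finite program and the semi-infinite
    -- program allow the same ratios
    (∀ x ∈ stdSimplex ℝ (Fin n), ∀ r : ℝ, 0 ≤ r →
      ((∃ lam, RobustPricing.LPFeasible hv φ v b x r lam) ↔
        ∃ lam, RobustPricing.SemiInfiniteFeasible φ (RobustPricing.levelPricing v x) r lam)) ∧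
    -- every feasible point of the finite program is a guarantee on the competitive ratio
    ((RobustPricing.ambiguitySet φ).Nonempty → ∀ x r lam,
      RobustPricing.LPFeasible hv φ v b x r lam →
        r ≤ RobustPricing.competitiveRatio φ (RobustPricing.levelPricing v x)) ∧
    -- the finite program solves the maximin problem
    (RobustPricing.StrictlyFeasible b φ →
      (∀ x ∈ stdSimplex ℝ (Fin n),
        IsGreatest {r : ℝ | ∃ lam, RobustPricing.LPFeasible hv φ v b x r lam}
          (RobustPricing.competitiveRatio φ (RobustPricing.levelPricing v x))) ∧
      ∃ R : ℝ,
        IsGreatest {r : ℝ | ∃ x lam, RobustPricing.LPFeasible hv φ v b x r lam} R ∧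
        IsGreatest (RobustPricing.competitiveRatio φ '' RobustPricing.levelPricings v) R) := by
  have hguar : (RobustPricing.ambiguitySet φ).Nonempty → ∀ x r lam,
      RobustPricing.LPFeasible hv φ v b x r lam →
        r ≤ RobustPricing.competitiveRatio φ (RobustPricing.levelPricing v x) := by
    intro hne x r lam h
    obtain ⟨lam', h'⟩ := h.exists_semiInfiniteFeasible hv hφ (fun s => (hb_mem s).2) hφb
    exact h'.le_competitiveRatio hv hφ (fun s => (hb_mem s).1) h.x_nonneg h.r_nonneg hne
  refine ⟨fun x hx r hr => ⟨fun ⟨lam, h⟩ =>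
    h.exists_semiInfiniteFeasible hv hφ (fun s => (hb_mem s).2) hφb,
    fun ⟨lam, h⟩ => h.exists_lpFeasible hv hφ hx hr⟩, hguar, fun hsf => ?_⟩
  have hne : (RobustPricing.ambiguitySet φ).Nonempty := by
    obtain ⟨F, hF, -⟩ := hsf
    exact ⟨F, hF⟩
  refine ⟨fun x hx => ⟨RobustPricing.exists_lpFeasible_competitiveRatio hv hφ hx hsf,
    fun r ⟨lam, h⟩ => hguar hne x r lam h⟩, ?_⟩
  -- An upper semicontinuous function attains its maximum on the compact simplex, which is nonempty
  -- because `0 < n`. By strong duality the maximizer is also optimal in the finite program.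
  obtain ⟨x, hx, hmax⟩ :=
    (RobustPricing.upperSemicontinuousOn_competitiveRatio (v := v) hne).exists_isMaxOn
      ⟨_, single_mem_stdSimplex ℝ (⟨0, hn⟩ : Fin n)⟩ (isCompact_stdSimplex ℝ (Fin n))
  refine ⟨_, ⟨⟨x, RobustPricing.exists_lpFeasible_competitiveRatio hv hφ hx hsf⟩, ?_⟩,
    ⟨_, ⟨x, hx, rfl⟩, rfl⟩, ?_⟩
  · rintro r ⟨z, lam, h⟩
    exact (hguar hne z r lam h).trans (hmax ⟨h.x_nonneg, h.sum_x⟩)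
  · rintro _ ⟨_, ⟨z, hz, rfl⟩, rfl⟩
    exact hmax hz
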